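/- Let $(\Omega,\Sigma,\mu)$ be a $\sigma$-finite complete measure space all of whose atoms are singletons (up to null sets). Let $\Omega^a=\{t:\mu(\{t\})>0\}$ and $\Omega^c=\Omega\setminus\Omega^a$, and let $L^0$ be the space of classes of a.e. equal measurable real functions on $\Omega$. A Young function is a function $f:[0,\infty)\to[0,\infty]$ with $f(0)=0$ and $\lim_{u\to\infty}f(u)=\infty$ that is convex on $[0,b_f)$ (on $[0,b_f]$ if $f(b_f)<\infty$), where $b_f=\sup\{u\ge 0: f(u)<\infty\}$; the case $b_f=0$ is allowed. A Musielak–Orlicz function is a function $\varphi:\Omega\times[0,\infty)\to[0,\infty]$ such that $\varphi(t,\cdot)$ is a Young function for a.e. $t$ and $\varphi(\cdot,u)$ is measurable for each $u\ge 0$. Put $I_\varphi(x)=\int_\Omega\varphi(t,|x(t)|)\,d\mu(t)$, $L^\varphi=\{x\in L^0: I_\varphi(\lambda x)<\infty\text{ for some }\lambda>0\}$, $\|x\|_\varphi=\inf\{\lambda>0: I_\varphi(x/\lambda)\le 1\}$, $b_\varphi(t)=\sup\{u\ge 0:\varphi(t,u)<\infty\}$ and $\varphi^{-1}(t,w)=\inf\{v\ge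 0:\varphi(t,v)>w\}$. Let $\varphi,\varphi_1$ be Musielak–Orlicz functions on $\Omega$ such that $\operatorname{supp}L^{\varphi_1}=\Omega$, i.e. some $x\in L^{\varphi_1}$ is nonzero almost everywhere. Define $$(\varphi\ominus\varphi_1)(t,u)=\begin{cases}\sup\{\varphi(t,su)-\varphi_1(t,s): 0\le s<b_{\varphi_1}(t)\}, & t\in\Omega^c,\\ \sup\bigl\{\varphi(t,su)-\varphi_1(t,s): 0\le s\le\min\bigl\{\varphi_1^{-1}\bigl(t,\tfrac{1}{\mu(\{t\})}\bigr),\tfrac{b_{\varphi_1}(t)}{2}\bigr\}\bigr\}, & t\in\Omega^a,\end{cases}$$ and $$M(L^{\varphi_1},L^{\varphi})=\{y\in L^0: xy\in L^\varphi\text{ for all }x\in L^{\varphi_1}\},\qquad \|y\|_M=\sup_{\|x\|_{\varphi_1}\le 1}\|xy\|_\varphi .$$ Then $\varphi\ominus\varphi_1$ is a Musielak–Orlicz function, $M(L^{\varphi_1},L^{\varphi})=L^{\varphi\ominus\varphi_1}$ as sets, and the two norms are finite and equivalent there: there is $C\in(0,\infty)$ (possibly depending on $\mu,\varphi,\varphi_1$)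 such that $\|y\|_M\le C\|y\|_{\varphi\ominus\varphi_1}$ and $\|y\|_{\varphi\ominus\varphi_1}\le C\|y\|_M$ for all $y\in M(L^{\varphi_1},L^{\varphi})$. -/

import Mathlib

open MeasureTheory Filter Topology Set
open scoped NNReal ENNReal

noncomputable section

namespace MusielakOrlicz

/-- `b_f = sup {u ≥ 0 : f u < ∞}`, as an element of `[0, ∞]`. -/
def finiteBound (f : ℝ≥0 → ℝ≥0∞) : ℝ≥0∞ :=
  ⨆ (u : ℝ≥0) (_ : f u < ⊤), (u : ℝ≥0∞)

/-- The right-continuous inverse `f⁻¹(w) = inf {v ≥ 0 : f v > w}`. -/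
def rightInv (f : ℝ≥0 → ℝ≥0∞) (w : ℝ≥0∞) : ℝ≥0∞ :=
  ⨅ (v : ℝ≥0) (_ : w < f v), (v : ℝ≥0∞)

/-- Young functions `f : [0, ∞) → [0, ∞]`. Since `f = ∞` beyond `b_f`, convexity on `[0, b_f)`
(on `[0, b_f]` if `f b_f < ∞`) is the same as convexity of the extended-valued function `f`
on `[0, ∞)`. No left-continuity at `b_f` is required, and `f u = ∞` for all `u > 0` is allowed. -/
structure IsYoung (f : ℝ≥0 → ℝ≥0∞) : Prop where
  map_zero : f 0 = 0
  tendsto_top : Tendsto f atTop (𝓝 ⊤)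
  convex : ConvexOn ℝ≥0 univ f

variable {Ω : Type*} [MeasurableSpace Ω]

/-- Musielak–Orlicz functions `φ : Ω × [0, ∞) → [0, ∞]`. -/
structure IsMusielakOrlicz (μ : Measure Ω) (φ : Ω → ℝ≥0 → ℝ≥0∞) : Prop where
  young : ∀ᵐ t ∂μ, IsYoung (φ t)
  measurable : ∀ u : ℝ≥0, Measurable fun t => φ t u

/-- The modular `I_φ(x) = ∫ φ(t, |x(t)|) dμ(t)`. -/
def modular (μ : Measure Ω) (φ : Ω → ℝ≥0 → ℝ≥0∞) (x : Ω →ₘ[μ] ℝ) : ℝ≥0∞ :=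
  ∫⁻ t, φ t ‖x t‖₊ ∂μ

/-- The Musielak–Orlicz space `L^φ`, as a set of classes of measurable functions. -/
def space (μ : Measure Ω) (φ : Ω → ℝ≥0 → ℝ≥0∞) : Set (Ω →ₘ[μ] ℝ) :=
  {x | ∃ c : ℝ, 0 < c ∧ modular μ φ (c • x) < ⊤}

/-- The Luxemburg–Nakano norm `inf {c > 0 : I_φ(x / c) ≤ 1}`, with values in `[0, ∞]`. -/
def luxNorm (μ : Measure Ω) (φ : Ω → ℝ≥0 → ℝ≥0∞) (x : Ω →ₘ[μ] ℝ) : ℝ≥0∞ :=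
  ⨅ (c : ℝ≥0) (_ : 0 < c ∧ modular μ φ ((c : ℝ)⁻¹ • x) ≤ 1), (c : ℝ≥0∞)

/-- `S` is a support of the set `X` of classes of measurable functions. -/
def IsSupport (μ : Measure Ω) (X : Set (Ω →ₘ[μ] ℝ)) (S : Set Ω) : Prop :=
  MeasurableSet S ∧
  (∀ x ∈ X, ∃ A : Set Ω, MeasurableSet A ∧ μ A = 0 ∧ {t | x t ≠ 0} ⊆ S ∪ A) ∧
  ∃ x ∈ X, μ (S \ {t | x t ≠ 0}) = 0

/-- The pointwise multipliers from `L^φ₁` to `L^φ`. -/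
def multipliers (μ : Measure Ω) (φ₁ φ : Ω → ℝ≥0 → ℝ≥0∞) : Set (Ω →ₘ[μ] ℝ) :=
  {y | ∀ x ∈ space μ φ₁, x * y ∈ space μ φ}

/-- The operator norm of the multiplier `y` from `L^φ₁` to `L^φ`, with values in `[0, ∞]`. -/
def multNorm (μ : Measure Ω) (φ₁ φ : Ω → ℝ≥0 → ℝ≥0∞) (y : Ω →ₘ[μ] ℝ) : ℝ≥0∞ :=
  ⨆ (x : Ω →ₘ[μ] ℝ) (_ : x ∈ space μ φ₁ ∧ luxNorm μ φ₁ x ≤ 1), luxNorm μ φ (x * y)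

/-- Atoms of a measure: measurable sets of positive measure that cannot be split into two
measurable parts of positive measure. -/
def IsMeasureAtom (μ : Measure Ω) (A : Set Ω) : Prop :=
  MeasurableSet A ∧ 0 < μ A ∧
    ∀ B : Set Ω, MeasurableSet B → B ⊆ A → μ B = 0 ∨ μ (A \ B) = 0

/-- All atoms are singletons, up to null sets. -/
def AtomsAreSingletons (μ : Measure Ω) : Prop :=
  ∀ A : Set Ω, IsMeasureAtom μ A → ∃ t ∈ A, MeasurableSet {t} ∧ μ (A \ {t}) = 0

/-- The purely atomic part of `Ω` (for a measure all of whose atoms are singletons). -/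
def atomicPart (μ : Measure Ω) : Set Ω := {t | 0 < μ {t}}

open Classical in
/-- The Young conjugate `φ ⊖ φ₁` of `φ₁` with respect to `φ`. The term for `s = 0` in each of
the suprema is `φ(t, 0) - φ₁(t, 0) = 0`, so that replacing the negative terms by `0`, as the
subtraction of `ℝ≥0∞` does, changes nothing; `φ₁(t, s)` is finite in the range of `s`. -/
def youngConj (μ : Measure Ω) (φ φ₁ : Ω → ℝ≥0 → ℝ≥0∞) (t : Ω) (u : ℝ≥0) : ℝ≥0∞ :=
  if t ∈ atomicPart μ then
    ⨆ (s : ℝ≥0) (_ : (s : ℝ≥0∞) ≤ min (rightInv (φ₁ t) (1 / μ {t})) (finiteBound (φ₁ t) / 2)),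
      (φ t (s * u) - φ₁ t s)
  else
    ⨆ (s : ℝ≥0) (_ : (s : ℝ≥0∞) < finiteBound (φ₁ t)), (φ t (s * u) - φ₁ t s)

end MusielakOrlicz

end

/-!
Write `ψ = φ ⊖ φ₁`. All constants below come from halving arguments, which absorb three defects of
the general setting: Young functions need not be left-continuous, `φ₁(t, ·)` may be finite at
`b_φ₁(t)`, and `t ↦ φ(t, x(t))` need not be measurable. For the last of these,
`IsMusielakOrlicz.exists_measurable_between` puts a measurable function between `φ(t, x(t) / 2)` and
`φ(t, x(t))`.

*Conjugate function.* Convexity and growth of `ψ(t, ·)` are pointwise. For measurability, the atomic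
part is a countable union of measurable singletons, and elsewhere the supremum can be taken over a
dense sequence of `s` (`youngConj_eq_iSup_denseSeq`).

*`L^ψ` consists of multipliers.* The Young inequality `φ(t, s u / 2) ≤ φ₁(t, s) + ψ(t, u)` holds
whenever, at an atom, `φ₁(t, s) μ{t} ≤ 1`; this holds at `s = |x(t)|` if `I_φ₁(x) ≤ 1`. Integrating
it bounds `‖xy‖_φ` (`luxNorm_mul_le`).

*Multipliers are in `L^ψ`.* A gliding hump argument shows that the operator norm of a multiplier
is finite (`multNorm_lt_top`). After rescaling, `I_φ₁(x) ≤ 1` implies `I_φ(xy) ≤ 1/2`. Choose `s(t)`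
measurably so that `φ(t, s|y|) - φ₁(t, s)` is nearly maximal, hence almost `ψ(t, |y|)`. If the
integral of `φ₁(t, s(t))` over `A` is at most `1`, then it is at most the integral of
`φ(t, s|y|)` over `A`, hence at most `1/2`. The indefinite integral of `φ₁(t, s(t))` therefore
skips the interval `(1/2, 1]`. Since its atoms have mass at most `1`, this forces the total to be at
most `1/2` (`AtomsAreSingletons.lintegral_le_half_of_gap`). So `s` itself has modular at most `1`,
and `∫ φ₁(t, s) + ∫ (φ(t, s|y|) - φ₁(t, s)) ≤ 1/2` bounds `I_ψ` of a multiple of `y`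
(`lintegral_youngConj_le`). -/

namespace MusielakOrlicz

/-! ### Young functions -/

section Young

variable {f : ℝ≥0 → ℝ≥0∞}

theorem IsYoung.map_mul_le (hf : IsYoung f) {a : ℝ≥0} (ha : a ≤ 1) (u : ℝ≥0) :
    f (a * u) ≤ a * f u := by
  have h := hf.convex.2 (mem_univ u) (mem_univ 0) (zero_le : 0 ≤ a) (zero_le : 0 ≤ 1 - a)
    (add_tsub_cancel_of_le ha)
  simpa [hf.map_zero, ENNReal.smul_def] using h

theorem IsYoung.monotone (hf : IsYoung f) : Monotone f := by
  intro u v huv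
  rcases eq_or_ne v 0 with rfl | hv
  · rw [nonpos_iff_eq_zero.1 huv]
  have ha : u / v ≤ 1 := div_le_one_of_le₀ huv zero_le
  calc f u = f (u / v * v) := by rw [div_mul_cancel₀ _ hv]
    _ ≤ (u / v : ℝ≥0) * f v := hf.map_mul_le ha v
    _ ≤ 1 * f v := by gcongr; exact_mod_cast ha
    _ = f v := one_mul _

theorem lt_finiteBound_iff {s : ℝ≥0} :
    (s : ℝ≥0∞) < finiteBound f ↔ ∃ u : ℝ≥0, f u < ⊤ ∧ s < u := by
  simp [finiteBound, lt_iSup_iff]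

theorem le_finiteBound {s : ℝ≥0} (hs : f s < ⊤) : (s : ℝ≥0∞) ≤ finiteBound f :=
  le_iSup₂ (f := fun (u : ℝ≥0) (_ : f u < ⊤) => (u : ℝ≥0∞)) s hs

theorem IsYoung.lt_top_of_lt_finiteBound (hf : IsYoung f) {s : ℝ≥0}
    (hs : (s : ℝ≥0∞) < finiteBound f) : f s < ⊤ := by
  obtain ⟨u, hu, hsu⟩ := lt_finiteBound_iff.1 hs
  exact (hf.monotone hsu.le).trans_lt hu

theorem le_of_lt_rightInv {s : ℝ≥0} {w : ℝ≥0∞}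
    (hs : (s : ℝ≥0∞) < rightInv f w) : f s ≤ w := by
  by_contra! h
  exact absurd (iInf₂_le (f := fun (v : ℝ≥0) (_ : w < f v) => (v : ℝ≥0∞)) s h) (not_le.2 hs)

theorem IsYoung.le_rightInv (hf : IsYoung f) {s : ℝ≥0} {w : ℝ≥0∞} (hs : f s ≤ w) :
    (s : ℝ≥0∞) ≤ rightInv f w := by
  refine le_iInf₂ fun v hv => ?_
  by_contra! h
  exact absurd (hs.trans_lt hv) (not_lt.2 (hf.monotone (by exact_mod_cast h.le)))

theorem IsYoung.rightInv_lt_top (hf : IsYoung f) {w : ℝ≥0∞} (hw : w ≠ ⊤) :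
    rightInv f w < ⊤ := by
  obtain ⟨v, hv⟩ := (hf.tendsto_top.eventually (lt_mem_nhds hw.lt_top)).exists
  exact (iInf₂_le (f := fun (v : ℝ≥0) (_ : w < f v) => (v : ℝ≥0∞)) v hv).trans_lt
    ENNReal.coe_lt_top

theorem IsYoung.exists_pos_le (hf : IsYoung f) (hb : 0 < finiteBound f) {w : ℝ≥0∞}
    (hw : 0 < w) : ∃ s : ℝ≥0, 0 < s ∧ f s ≤ w := by
  obtain ⟨u, hu, hu0⟩ := lt_finiteBound_iff.1 (show ((0 : ℝ≥0) : ℝ≥0∞) < _ by simpa using hb)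
  obtain ⟨a, ha0, ha⟩ : ∃ a : ℝ≥0, 0 < a ∧ a * f u < w :=
    ENNReal.exists_nnreal_pos_mul_lt hu.ne hw.ne'
  refine ⟨min a 1 * u, mul_pos (lt_min ha0 one_pos) hu0, ?_⟩
  refine (hf.map_mul_le (min_le_right _ _) u).trans (le_trans ?_ ha.le)
  gcongr
  exact min_le_left _ _

/-- Right-continuity of a Young function on `[0, b_f)`. -/
theorem IsYoung.exists_forall_le_add (hf : IsYoung f) {s : ℝ≥0}
    (hs : (s : ℝ≥0∞) < finiteBound f) {ε : ℝ≥0} (hε : 0 < ε) :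
    ∃ r : ℝ≥0, s < r ∧ (r : ℝ≥0∞) ≤ finiteBound f ∧ ∀ q, s ≤ q → q ≤ r → f q ≤ f s + ε := by
  obtain ⟨p, hp, hsp⟩ := lt_finiteBound_iff.1 hs
  obtain ⟨a, ha0, ha⟩ : ∃ a : ℝ≥0, 0 < a ∧ a * f p < ε :=
    ENNReal.exists_nnreal_pos_mul_lt hp.ne (by exact_mod_cast hε.ne')
  set b := min a 1
  have hb1 : b ≤ 1 := min_le_right _ _
  have hb0 : 0 < b := lt_min ha0 one_pos
  -- The bound at `r = (1 - b) s + b p` comes from convexity, at the points before from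
  -- monotonicity.
  have hr : (1 - b) * s + b * p = s + b * (p - s) := by
    apply NNReal.eq
    push_cast [NNReal.coe_sub hb1, NNReal.coe_sub hsp.le]
    ring
  have hrp : s + b * (p - s) ≤ p := by
    calc s + b * (p - s) ≤ s + 1 * (p - s) := by gcongr
      _ = p := by rw [one_mul, add_tsub_cancel_of_le hsp.le]
  refine ⟨s + b * (p - s), lt_add_of_pos_right _ (mul_pos hb0 (tsub_pos_of_lt hsp)),
    le_trans (by exact_mod_cast hrp) (le_finiteBound hp), fun q _ hq => ?_⟩
  have h := hf.convex.2 (mem_univ s) (mem_univ p) (zero_le : 0 ≤ 1 - b) hb0.le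
    (tsub_add_cancel_of_le hb1)
  simp only [smul_eq_mul, ENNReal.smul_def] at h
  rw [hr] at h
  refine (hf.monotone hq).trans (h.trans (add_le_add ?_ (le_trans ?_ ha.le)))
  · calc ((1 - b : ℝ≥0) : ℝ≥0∞) * f s ≤ 1 * f s := by
          gcongr; exact_mod_cast tsub_le_self
      _ = f s := one_mul _
  · gcongr
    exact min_le_left _ _

end Young

variable {Ω : Type*} [MeasurableSpace Ω] {μ : Measure Ω}

/-! ### Atoms and small sets -/

theorem measure_singleton_lt_top [SigmaFinite μ] (t : Ω) : μ {t} < ⊤ := by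
  obtain ⟨n, hn⟩ := mem_iUnion.1 ((iUnion_spanningSets μ).symm ▸ mem_univ t)
  exact (measure_mono (singleton_subset_iff.2 hn)).trans_lt (measure_spanningSets_lt_top μ n)

/-- A point of positive outer measure spans an atom, namely its measurable hull; so it is the
point carrying that atom. -/
theorem AtomsAreSingletons.measurableSet_singleton [SigmaFinite μ] (h : AtomsAreSingletons μ)
    {t : Ω} (ht : t ∈ atomicPart μ) : MeasurableSet {t} := by
  have htH : t ∈ toMeasurable μ {t} := subset_toMeasurable μ _ rfl
  have key : ∀ B : Set Ω, t ∈ B → MeasurableSet B →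
      μ (toMeasurable μ {t} \ B) = 0 := fun B hB hBm => by
    have h1 : μ (toMeasurable μ {t}) ≤ μ (toMeasurable μ {t} ∩ B) := by
      rw [measure_toMeasurable]
      exact measure_mono (singleton_subset_iff.2 ⟨htH, hB⟩)
    have h2 := measure_inter_add_sdiff (μ := μ) (toMeasurable μ {t}) hBm
    have h3 : μ (toMeasurable μ {t} ∩ B) ≠ ⊤ := by
      refine ne_top_of_le_ne_top ?_ (measure_mono inter_subset_left)
      rw [measure_toMeasurable]
      exact (measure_singleton_lt_top t).ne
    rw [← h2] at h1
    by_contra h0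
    exact absurd h1 (not_le.2 (ENNReal.lt_add_right h3 h0))
  have hatom : IsMeasureAtom μ (toMeasurable μ {t}) := by
    refine ⟨measurableSet_toMeasurable _ _, by rw [measure_toMeasurable]; exact ht,
      fun B hB hBH => ?_⟩
    by_cases htB : t ∈ B
    · exact Or.inr (key B htB hB)
    · exact Or.inl (measure_mono_null
        (show B ⊆ toMeasurable μ {t} \ Bᶜ from fun x hx => ⟨hBH hx, fun hx' => hx' hx⟩)
        (key Bᶜ htB hB.compl))
  obtain ⟨t', -, ht', h0⟩ := h _ hatom
  by_cases hne : t = t'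
  · exact hne ▸ ht'
  · exact absurd (measure_mono_null
      (singleton_subset_iff.2 (show t ∈ toMeasurable μ {t} \ {t'} from ⟨htH, hne⟩)) h0)
      (ne_of_gt ht)

theorem AtomsAreSingletons.countable_atomicPart [SigmaFinite μ] (h : AtomsAreSingletons μ) :
    (atomicPart μ).Countable := by
  have := Measure.countable_meas_pos_of_disjoint_iUnion (μ := μ)
    (As := fun t : atomicPart μ => {(t : Ω)}) (fun t => h.measurableSet_singleton t.2)
    (fun a b hab => by
      simpa [Function.onFun, disjoint_singleton] using fun h => hab (Subtype.ext h))
  have h2 : {i : atomicPart μ | 0 < μ {(i : Ω)}} = univ := eq_univ_of_forall fun i => i.2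
  rw [h2, countable_univ_iff] at this
  exact this

theorem AtomsAreSingletons.measurableSet_atomicPart [SigmaFinite μ]
    (h : AtomsAreSingletons μ) : MeasurableSet (atomicPart μ) := by
  rw [← biUnion_of_singleton (atomicPart μ)]
  exact MeasurableSet.biUnion h.countable_atomicPart fun t ht => h.measurableSet_singleton ht

/-- On the atomic part, measurability is automatic. -/
theorem AtomsAreSingletons.measurable_ite [SigmaFinite μ] (h : AtomsAreSingletons μ)
    {β : Type*} [MeasurableSpace β] (f : Ω → β) {g : Ω → β} (hg : Measurable g)
    [DecidablePred (· ∈ atomicPart μ)] :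
    Measurable fun t => if t ∈ atomicPart μ then f t else g t := by
  refine measurable_of_restrict_of_restrict_compl h.measurableSet_atomicPart ?_ ?_
  · have : Countable (atomicPart μ) := h.countable_atomicPart
    have : MeasurableSingletonClass (atomicPart μ) := ⟨fun t => by
      have h1 := measurable_subtype_coe (p := (· ∈ atomicPart μ)) (h.measurableSet_singleton t.2)
      have h2 : (Subtype.val ⁻¹' {(t : Ω)} : Set (atomicPart μ)) = {t} := by
        ext s; simp [Subtype.ext_iff]
      rwa [h2] at h1⟩
    exact measurable_of_countable _
  · convert hg.comp (measurable_subtype_coe (p := (· ∈ (atomicPart μ)ᶜ))) using 1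
    ext t
    simp [show (t : Ω) ∉ atomicPart μ from t.2]

/-- Off the atomic part, sets of positive measure can be halved again and again. -/
theorem AtomsAreSingletons.exists_subset_measure_le (h : AtomsAreSingletons μ) {A : Set Ω}
    (hA : MeasurableSet A) (hAc : A ⊆ (atomicPart μ)ᶜ) (h0 : μ A ≠ 0) (htop : μ A ≠ ⊤)
    {ε : ℝ≥0∞} (hε : ε ≠ 0) :
    ∃ B ⊆ A, MeasurableSet B ∧ μ B ≠ 0 ∧ μ B ≤ ε := by
  have half : ∀ n : ℕ, ∃ B ⊆ A, MeasurableSet B ∧ μ B ≠ 0 ∧ μ B ≤ 2⁻¹ ^ n * μ A := by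
    intro n
    induction n with
    | zero => exact ⟨A, Subset.rfl, hA, h0, by simp⟩
    | succ n ih =>
      obtain ⟨B, hBA, hB, hB0, hBn⟩ := ih
      obtain ⟨C, hC, hCB, hC0, hC1⟩ :
          ∃ C, MeasurableSet C ∧ C ⊆ B ∧ μ C ≠ 0 ∧ μ (B \ C) ≠ 0 := by
        by_contra! hcon
        obtain ⟨t, htB, -, ht⟩ := h B ⟨hB, pos_iff_ne_zero.2 hB0, fun C hC hCB =>
          or_iff_not_imp_left.2 (hcon C hC hCB)⟩
        refine hAc (hBA htB) (pos_iff_ne_zero.2 (fun h1 : μ {t} = 0 => hB0 ?_) : 0 < μ {t})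
        refine measure_mono_null (fun x hx => ?_) (measure_union_null h1 ht)
        by_cases hxt : x = t
        · exact Or.inl hxt
        · exact Or.inr ⟨hx, hxt⟩
      have hsum : μ C + μ (B \ C) = μ B := by
        rw [← measure_inter_add_sdiff B hC, inter_eq_right.2 hCB]
      have hhalf : 2⁻¹ ^ (n + 1) * μ A = 2⁻¹ * (2⁻¹ ^ n * μ A) := by rw [pow_succ']; ring
      rcases le_or_gt (μ C) (2⁻¹ * μ B) with hle | hlt
      · exact ⟨C, hCB.trans hBA, hC, hC0, hle.trans (by rw [hhalf]; gcongr)⟩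
      · refine ⟨B \ C, sdiff_subset.trans hBA, hB.diff hC, hC1, ?_⟩
        have : μ (B \ C) ≤ 2⁻¹ * μ B := by
          by_contra! hcon
          have h3 := ENNReal.add_lt_add hlt hcon
          rw [hsum, ← add_mul, ENNReal.inv_two_add_inv_two, one_mul] at h3
          exact lt_irrefl _ h3
        exact this.trans (by rw [hhalf]; gcongr)
  have hlim : Tendsto (fun n : ℕ => (2⁻¹ : ℝ≥0∞) ^ n * μ A) atTop (𝓝 (0 * μ A)) :=
    ENNReal.Tendsto.mul_const (ENNReal.tendsto_pow_atTop_nhds_zero_of_lt_one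
      (ENNReal.inv_lt_one.2 ENNReal.one_lt_two)) (Or.inr htop)
  rw [zero_mul] at hlim
  obtain ⟨n, hn⟩ := (hlim.eventually (gt_mem_nhds (pos_iff_ne_zero.2 hε))).exists
  obtain ⟨B, hBA, hB, hB0, hBn⟩ := half n
  exact ⟨B, hBA, hB, hB0, hBn.trans hn.le⟩

/-- A set with nonzero integral has a subset with integral in `(0, 1]`: a point of the atomic part,
or a small subset of the rest on which `f` is bounded. -/
theorem AtomsAreSingletons.exists_subset_setLIntegral_le_one [SigmaFinite μ]
    (h : AtomsAreSingletons μ) {f : Ω → ℝ≥0∞} (hf : Measurable f) (hfin : ∀ᵐ t ∂μ, f t < ⊤)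
    (hatom : ∀ t ∈ atomicPart μ, f t * μ {t} ≤ 1) {H : Set Ω} (hH : MeasurableSet H)
    (hH0 : ∫⁻ t in H, f t ∂μ ≠ 0) :
    ∃ B ⊆ H, MeasurableSet B ∧ ∫⁻ t in B, f t ∂μ ≠ 0 ∧ ∫⁻ t in B, f t ∂μ ≤ 1 := by
  by_cases hex : ∃ t ∈ H, t ∈ atomicPart μ ∧ f t ≠ 0
  · obtain ⟨t, htH, ht, hft⟩ := hex
    have hm := h.measurableSet_singleton ht
    have hint : ∫⁻ s in {t}, f s ∂μ = f t * μ {t} := by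
      rw [setLIntegral_congr_fun (g := fun _ => f t) hm (fun s hs => by
        rw [mem_singleton_iff.1 hs]), setLIntegral_const]
    refine ⟨{t}, singleton_subset_iff.2 htH, hm, ?_, ?_⟩
    · rw [hint]
      exact mul_ne_zero hft (ne_of_gt ht)
    · rw [hint]
      exact hatom t ht
  · push Not at hex
    set E : ℕ → Set Ω := fun n =>
      (H ∩ (atomicPart μ)ᶜ ∩ {t | f t ≠ 0} ∩ {t | f t ≤ n}) ∩ spanningSets μ n with hE
    have hEm : ∀ n, MeasurableSet (E n) := fun n =>
      (((hH.inter h.measurableSet_atomicPart.compl).inter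
        (measurableSet_eq_fun hf measurable_const).compl).inter
        (measurableSet_le hf measurable_const)).inter (measurableSet_spanningSets μ n)
    obtain ⟨n, hn⟩ : ∃ n, μ (E n) ≠ 0 := by
      by_contra! hcon
      apply hH0
      rw [lintegral_eq_zero_iff hf, EventuallyEq, ae_restrict_iff' hH]
      have hnull : ∀ᵐ t ∂μ, t ∉ ⋃ n, E n := measure_eq_zero_iff_ae_notMem.1
        (measure_iUnion_null hcon)
      filter_upwards [hnull, hfin] with t ht htop htH
      by_contra hft
      obtain ⟨k, hk⟩ := ENNReal.exists_nat_gt htop.ne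
      obtain ⟨m, hm⟩ := mem_iUnion.1 ((iUnion_spanningSets μ).symm ▸ mem_univ t)
      refine ht (mem_iUnion.2 ⟨max k m, ⟨⟨⟨htH, fun hta => hft (hex t htH hta)⟩, hft⟩, ?_⟩,
        monotone_spanningSets μ (le_max_right k m) hm⟩)
      exact hk.le.trans (by exact_mod_cast le_max_left k m)
    obtain ⟨B, hBE, hB, hB0, hBn⟩ := h.exists_subset_measure_le (hEm n)
      (fun t ht => ht.1.1.1.2) hn
      (ne_top_of_le_ne_top (measure_spanningSets_lt_top μ n).ne (measure_mono inter_subset_right))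
      (ε := (n : ℝ≥0∞)⁻¹) (by simp)
    refine ⟨B, fun t ht => (hBE ht).1.1.1.1, hB, fun hz => hB0 ?_, ?_⟩
    · rw [lintegral_eq_zero_iff hf, EventuallyEq, ae_restrict_iff' hB] at hz
      refine measure_eq_zero_iff_ae_notMem.2 ?_
      filter_upwards [hz] with t ht htB
      exact (hBE htB).1.1.2 (ht htB)
    · calc ∫⁻ t in B, f t ∂μ ≤ ∫⁻ _ in B, (n : ℝ≥0∞) ∂μ :=
            setLIntegral_mono measurable_const fun t ht => (hBE ht).1.2
        _ = n * μ B := setLIntegral_const _ _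
        _ ≤ n * (n : ℝ≥0∞)⁻¹ := by gcongr
        _ ≤ 1 := ENNReal.mul_inv_le_one _

/-- The gap principle: if the indefinite integral of `f` takes no values in `(1/2, 1]` and no
atom has mass above `1`, then the total integral is at most `1/2`. The sets with integral at most
`1/2` are closed under countable unions, and a set of maximal integral among them exhausts `f`. -/
theorem AtomsAreSingletons.lintegral_le_half_of_gap [SigmaFinite μ]
    (h : AtomsAreSingletons μ) {f : Ω → ℝ≥0∞} (hf : Measurable f) (hfin : ∀ᵐ t ∂μ, f t < ⊤)
    (hatom : ∀ t ∈ atomicPart μ, f t * μ {t} ≤ 1)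
    (hgap : ∀ A, MeasurableSet A → ∫⁻ t in A, f t ∂μ ≤ 1 → ∫⁻ t in A, f t ∂μ ≤ 2⁻¹) :
    ∫⁻ t, f t ∂μ ≤ 2⁻¹ := by
  set ν := μ.withDensity f with hν
  have hνA : ∀ A, MeasurableSet A → ν A = ∫⁻ t in A, f t ∂μ := fun A hA =>
    withDensity_apply f hA
  have hunion : ∀ A B, MeasurableSet A → MeasurableSet B → ν A ≤ 2⁻¹ → ν B ≤ 2⁻¹ →
      ν (A ∪ B) ≤ 2⁻¹ := fun A B hA hB h1 h2 => by
    rw [hνA _ (hA.union hB)]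
    refine hgap _ (hA.union hB) ?_
    rw [← hνA _ (hA.union hB), ← ENNReal.inv_two_add_inv_two]
    exact (measure_union_le A B).trans (add_le_add h1 h2)
  set 𝒢 : Set ℝ≥0∞ := {r | ∃ A, MeasurableSet A ∧ ν A ≤ 2⁻¹ ∧ ν A = r} with h𝒢
  obtain ⟨u, -, hu, hmem⟩ := exists_seq_tendsto_sSup (S := 𝒢)
    ⟨0, ∅, MeasurableSet.empty, by simp, by simp⟩ (OrderTop.bddAbove _)
  choose A hAm hA hAu using hmem
  have hacc : ∀ n, ν (accumulate A n) ≤ 2⁻¹ := by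
    intro n
    induction n with
    | zero => simpa using hA 0
    | succ n ih =>
      rw [accumulate_succ]
      exact hunion _ _ (MeasurableSet.biUnion (to_countable _) fun i _ => hAm i) (hAm _) ih (hA _)
  set G := ⋃ n, A n with hG
  have hGm : MeasurableSet G := MeasurableSet.iUnion hAm
  have hG2 : ν G ≤ 2⁻¹ := by
    rw [hG, measure_iUnion_eq_iSup_accumulate]
    exact iSup_le hacc
  have hmax : ∀ B, MeasurableSet B → ν B ≤ 2⁻¹ → ν B ≤ ν G := fun B hB hB2 => by
    have h1 : ν B ≤ sSup 𝒢 := le_sSup ⟨B, hB, hB2, rfl⟩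
    refine h1.trans (le_of_tendsto' hu fun n => ?_)
    rw [← hAu n]
    exact measure_mono (subset_iUnion A n)
  have hcompl : ν Gᶜ = 0 := by
    by_contra hne
    rw [hνA _ hGm.compl] at hne
    obtain ⟨B, hBG, hB, hB0, hB1⟩ :=
      h.exists_subset_setLIntegral_le_one hf hfin hatom hGm.compl hne
    have hle := hmax _ (hGm.union hB)
      (hunion _ _ hGm hB hG2 (by rw [hνA _ hB]; exact hgap B hB hB1))
    rw [measure_union (disjoint_left.2 fun x hx hx' => hBG hx' hx) hB, hνA B hB] at hle
    exact absurd hle (not_le.2 (ENNReal.lt_add_right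
      (ne_top_of_le_ne_top (by simp) hG2) hB0))
  calc ∫⁻ t, f t ∂μ = ν univ := by rw [hνA _ MeasurableSet.univ, setLIntegral_univ]
    _ = ν G + ν Gᶜ := (measure_add_measure_compl hGm).symm
    _ ≤ 2⁻¹ := by rw [hcompl, add_zero]; exact hG2

/-! ### Modulars and the Luxemburg norm -/

variable {φ φ₁ : Ω → ℝ≥0 → ℝ≥0∞}

/-- For measurable `p`, the function `t ↦ φ t (p t)` may fail to be measurable, because `φ t` may
jump at the end of its domain of finiteness in a way that depends non-measurably on `t`. Up to
halving the argument, it is comparable to a measurable function. -/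
theorem IsMusielakOrlicz.exists_measurable_between (hφ : IsMusielakOrlicz μ φ) {p : Ω → ℝ≥0}
    (hp : Measurable p) :
    ∃ g : Ω → ℝ≥0∞, Measurable g ∧ ∀ᵐ t ∂μ, φ t (p t / 2) ≤ g t ∧ g t ≤ φ t (p t) := by
  set d := TopologicalSpace.denseSeq ℝ≥0
  refine ⟨fun t => ⨆ n, {t | d n ≤ p t}.indicator (fun t => φ t (d n)) t,
    Measurable.iSup fun n => (hφ.measurable _).indicator (measurableSet_le measurable_const hp), ?_⟩
  filter_upwards [hφ.young] with t ht
  constructor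
  · rcases eq_or_ne (p t) 0 with h0 | h0
    · simp [h0, ht.map_zero]
    obtain ⟨_, ⟨n, rfl⟩, h1, h2⟩ := (TopologicalSpace.denseRange_denseSeq ℝ≥0).exists_between
      (NNReal.half_lt_self h0)
    refine le_iSup_of_le n ?_
    rw [indicator_of_mem (show t ∈ {t | d n ≤ p t} from h2.le)]
    exact ht.monotone h1.le
  · refine iSup_le fun n => indicator_apply_le' (fun h => ht.monotone h) fun _ => zero_le

theorem IsMusielakOrlicz.lintegral_map_mul_le (hφ : IsMusielakOrlicz μ φ) {a : ℝ≥0} (ha : a ≤ 1)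
    (p : Ω → ℝ≥0) : ∫⁻ t, φ t (a * p t) ∂μ ≤ a * ∫⁻ t, φ t (p t) ∂μ := by
  rw [← lintegral_const_mul' _ _ ENNReal.coe_ne_top]
  refine lintegral_mono_ae ?_
  filter_upwards [hφ.young] with t ht using ht.map_mul_le ha _

theorem modular_smul (c : ℝ) (x : Ω →ₘ[μ] ℝ) :
    modular μ φ (c • x) = ∫⁻ t, φ t (‖c‖₊ * ‖x t‖₊) ∂μ := by
  refine lintegral_congr_ae ?_
  filter_upwards [AEEqFun.coeFn_smul c x] with t ht
  rw [ht, Pi.smul_apply, nnnorm_smul]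

theorem modular_inv_smul (c : ℝ≥0) (x : Ω →ₘ[μ] ℝ) :
    modular μ φ ((c : ℝ)⁻¹ • x) = ∫⁻ t, φ t (c⁻¹ * ‖x t‖₊) ∂μ := by
  rw [modular_smul, nnnorm_inv, NNReal.nnnorm_eq]

theorem IsMusielakOrlicz.luxNorm_le (hφ : IsMusielakOrlicz μ φ) {x : Ω →ₘ[μ] ℝ} {a K : ℝ≥0}
    (ha : 0 < a) (hK : 1 ≤ K) (h : ∫⁻ t, φ t (a * ‖x t‖₊) ∂μ ≤ K) :
    luxNorm μ φ x ≤ (K / a : ℝ≥0) := by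
  have hK0 : 0 < K := one_pos.trans_le hK
  refine iInf₂_le (f := fun (c : ℝ≥0) (_ : 0 < c ∧ modular μ φ ((c : ℝ)⁻¹ • x) ≤ 1) =>
    (c : ℝ≥0∞)) (K / a) ⟨div_pos hK0 ha, ?_⟩
  rw [modular_inv_smul]
  have : ∀ t, (K / a)⁻¹ * ‖x t‖₊ = K⁻¹ * (a * ‖x t‖₊) := fun t => by
    rw [inv_div, div_eq_mul_inv]; ring
  simp only [this]
  refine (hφ.lintegral_map_mul_le (inv_le_one_of_one_le₀ hK) _).trans ?_
  calc ((K⁻¹ : ℝ≥0) : ℝ≥0∞) * ∫⁻ t, φ t (a * ‖x t‖₊) ∂μ ≤ (K⁻¹ : ℝ≥0) * K := by gcongr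
    _ = 1 := by rw [← ENNReal.coe_mul, inv_mul_cancel₀ hK0.ne', ENNReal.coe_one]

theorem IsMusielakOrlicz.lintegral_le_of_luxNorm_lt (hφ : IsMusielakOrlicz μ φ)
    {x : Ω →ₘ[μ] ℝ} {c a : ℝ≥0} (h : luxNorm μ φ x < c) (ha : a ≤ 1) :
    ∫⁻ t, φ t (a * (c⁻¹ * ‖x t‖₊)) ∂μ ≤ a := by
  simp only [luxNorm, iInf_lt_iff] at h
  obtain ⟨b, ⟨hb, hmod⟩, hbc⟩ := h
  have hbc' : b < c := by exact_mod_cast hbc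
  have hc : c ≠ 0 := (hb.trans hbc').ne'
  have hle : b / c ≤ 1 := div_le_one_of_le₀ hbc'.le zero_le
  have : ∀ t, a * (c⁻¹ * ‖x t‖₊) = (a * (b / c)) * (b⁻¹ * ‖x t‖₊) := fun t => by
    field_simp
  simp only [this]
  rw [modular_inv_smul] at hmod
  refine (hφ.lintegral_map_mul_le (mul_le_one' ha hle) _).trans ?_
  calc ((a * (b / c) : ℝ≥0) : ℝ≥0∞) * ∫⁻ t, φ t (b⁻¹ * ‖x t‖₊) ∂μ
      ≤ ((a * 1 : ℝ≥0) : ℝ≥0∞) * 1 := by gcongr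
    _ = a := by simp

theorem IsMusielakOrlicz.mem_space_iff (hφ : IsMusielakOrlicz μ φ) {x : Ω →ₘ[μ] ℝ} :
    x ∈ space μ φ ↔ luxNorm μ φ x < ⊤ := by
  constructor
  · rintro ⟨c, hc, h⟩
    rw [modular_smul] at h
    refine (hφ.luxNorm_le (K := max 1 (∫⁻ t, φ t (‖c‖₊ * ‖x t‖₊) ∂μ).toNNReal)
      (nnnorm_pos.2 hc.ne') (le_max_left _ _) ?_).trans_lt ENNReal.coe_lt_top
    conv_lhs => rw [← ENNReal.coe_toNNReal h.ne]
    exact_mod_cast le_max_right _ _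
  · intro h
    obtain ⟨c, hc, -⟩ := ENNReal.lt_iff_exists_nnreal_btwn.1 h
    have hc0 : 0 < c := by exact_mod_cast (zero_le.trans_lt hc)
    refine ⟨(c : ℝ)⁻¹, by positivity, ?_⟩
    rw [modular_inv_smul]
    have := hφ.lintegral_le_of_luxNorm_lt hc le_rfl
    simp only [one_mul] at this
    exact this.trans_lt ENNReal.coe_lt_top

/-! ### The Young conjugate is a Musielak–Orlicz function -/

open Classical in
/-- The set of the `s` over which the supremum defining `φ ⊖ φ₁` at `t` is taken. -/
def conjRange (μ : Measure Ω) (φ₁ : Ω → ℝ≥0 → ℝ≥0∞) (t : Ω) : Set ℝ≥0 :=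
  {s | if t ∈ atomicPart μ then
      (s : ℝ≥0∞) ≤ min (rightInv (φ₁ t) (1 / μ {t})) (finiteBound (φ₁ t) / 2)
    else (s : ℝ≥0∞) < finiteBound (φ₁ t)}

theorem youngConj_eq_iSup (t : Ω) (u : ℝ≥0) :
    youngConj μ φ φ₁ t u = ⨆ s ∈ conjRange μ φ₁ t, (φ t (s * u) - φ₁ t s) := by
  unfold youngConj conjRange
  split_ifs with h <;> simp

theorem conjRange_mem_of_le {t : Ω} {s r : ℝ≥0} (hr : r ∈ conjRange μ φ₁ t) (hsr : s ≤ r) :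
    s ∈ conjRange μ φ₁ t := by
  have h : (s : ℝ≥0∞) ≤ r := by exact_mod_cast hsr
  unfold conjRange at *
  split_ifs at * with ht
  · exact h.trans hr
  · exact h.trans_lt hr

theorem lt_finiteBound_of_mem_conjRange {t : Ω} (hb : 0 < finiteBound (φ₁ t)) {s : ℝ≥0}
    (hs : s ∈ conjRange μ φ₁ t) : (s : ℝ≥0∞) < finiteBound (φ₁ t) := by
  unfold conjRange at hs
  split_ifs at hs with ht
  · have h2 := (le_min_iff.1 (show (s : ℝ≥0∞) ≤ min _ _ from hs)).2
    rcases eq_or_ne (finiteBound (φ₁ t)) ⊤ with htop | htop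
    · rw [htop]
      exact ENNReal.coe_lt_top
    · exact h2.trans_lt (ENNReal.half_lt_self hb.ne' htop)
  · exact hs

theorem exists_pos_mem_conjRange [SigmaFinite μ] {t : Ω} (hy : IsYoung (φ₁ t))
    (hb : 0 < finiteBound (φ₁ t)) : ∃ s : ℝ≥0, 0 < s ∧ s ∈ conjRange μ φ₁ t := by
  unfold conjRange
  split_ifs with ht
  · obtain ⟨s, hs0, hs⟩ := hy.exists_pos_le hb (w := 1 / μ {t})
      (ENNReal.div_pos one_ne_zero (measure_singleton_lt_top t).ne)
    obtain ⟨r, hr0, hr⟩ := ENNReal.lt_iff_exists_nnreal_btwn.1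
      (show 0 < finiteBound (φ₁ t) / 2 from ENNReal.half_pos hb.ne')
    refine ⟨min s r, lt_min hs0 (by exact_mod_cast hr0),
      (le_min ?_ ?_ : ((min s r : ℝ≥0) : ℝ≥0∞) ≤ _)⟩
    · exact le_trans (by exact_mod_cast min_le_left s r) (hy.le_rightInv hs)
    · exact le_trans (by exact_mod_cast min_le_right s r) hr.le
  · obtain ⟨r, hr0, hr⟩ := ENNReal.lt_iff_exists_nnreal_btwn.1 hb
    exact ⟨r, by exact_mod_cast hr0, hr⟩

theorem isYoung_youngConj [SigmaFinite μ] {t : Ω} (hφ : IsYoung (φ t)) (hφ₁ : IsYoung (φ₁ t))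
    (hb : 0 < finiteBound (φ₁ t)) : IsYoung (youngConj μ φ φ₁ t) where
  map_zero := by simp [youngConj_eq_iSup, hφ.map_zero]
  tendsto_top := by
    obtain ⟨s, hs0, hs⟩ := exists_pos_mem_conjRange (μ := μ) hφ₁ hb
    have hfin := hφ₁.lt_top_of_lt_finiteBound (lt_finiteBound_of_mem_conjRange hb hs)
    rw [ENNReal.tendsto_nhds_top_iff_nnreal]
    intro x
    have h1 : Tendsto (fun u : ℝ≥0 => φ t (s * u)) atTop (𝓝 ⊤) :=
      hφ.tendsto_top.comp (tendsto_id.const_mul_atTop hs0)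
    filter_upwards [h1.eventually (lt_mem_nhds (show x + φ₁ t s < ⊤ from
      ENNReal.add_lt_top.2 ⟨ENNReal.coe_lt_top, hfin⟩))] with u hu
    rw [youngConj_eq_iSup]
    exact (lt_tsub_iff_right.2 hu).trans_le
      (le_iSup₂ (f := fun s (_ : s ∈ conjRange μ φ₁ t) => φ t (s * u) - φ₁ t s) s hs)
  convex := by
    refine ⟨convex_univ, fun u _ v _ a b _ _ hab => ?_⟩
    simp only [youngConj_eq_iSup, ENNReal.smul_def, smul_eq_mul]
    refine iSup₂_le fun s hs => ?_
    have hle : ∀ w, φ t (s * w) ≤ (⨆ s ∈ conjRange μ φ₁ t, (φ t (s * w) - φ₁ t s)) + φ₁ t s :=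
      fun w => tsub_le_iff_right.1
        (le_iSup₂ (f := fun s (_ : s ∈ conjRange μ φ₁ t) => φ t (s * w) - φ₁ t s) s hs)
    rw [tsub_le_iff_right]
    have h := hφ.convex.2 (mem_univ (s * u)) (mem_univ (s * v)) (zero_le : 0 ≤ a)
      (zero_le : 0 ≤ b) hab
    simp only [ENNReal.smul_def, smul_eq_mul] at h
    have hab' : (a : ℝ≥0∞) + b = 1 := by exact_mod_cast hab
    calc φ t (s * (a * u + b * v)) = φ t (a * (s * u) + b * (s * v)) := by congr 1; ring
      _ ≤ a * φ t (s * u) + b * φ t (s * v) := h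
      _ ≤ a * ((⨆ s ∈ conjRange μ φ₁ t, (φ t (s * u) - φ₁ t s)) + φ₁ t s) +
          b * ((⨆ s ∈ conjRange μ φ₁ t, (φ t (s * v) - φ₁ t s)) + φ₁ t s) := by
        gcongr
        exacts [hle u, hle v]
      _ = a * (⨆ s ∈ conjRange μ φ₁ t, (φ t (s * u) - φ₁ t s)) +
          b * (⨆ s ∈ conjRange μ φ₁ t, (φ t (s * v) - φ₁ t s)) + (a + b) * φ₁ t s := by ring
      _ = _ := by rw [hab', one_mul]

theorem IsMusielakOrlicz.ae_finiteBound_pos (hφ₁ : IsMusielakOrlicz μ φ₁)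
    (hsupp : IsSupport μ (space μ φ₁) univ) : ∀ᵐ t ∂μ, 0 < finiteBound (φ₁ t) := by
  obtain ⟨x, ⟨c, hc, hx⟩, hx0⟩ := hsupp.2.2
  rw [modular_smul] at hx
  obtain ⟨g, hg, hgle⟩ := hφ₁.exists_measurable_between
    (p := fun t => ‖c‖₊ * ‖x t‖₊) (x.measurable.nnnorm.const_mul _)
  have hgfin : ∫⁻ t, g t ∂μ ≠ ⊤ :=
    ((lintegral_mono_ae (hgle.mono fun t h => h.2)).trans_lt hx).ne
  have hne : ∀ᵐ t ∂μ, x t ≠ 0 := by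
    rw [ae_iff]
    refine measure_mono_null (fun t ht => ?_) hx0
    exact ⟨mem_univ t, fun h => h (not_not.1 ht)⟩
  filter_upwards [hgle, ae_lt_top hg hgfin, hne] with t h1 h2 h3
  refine lt_of_lt_of_le ?_ (le_finiteBound (h1.1.trans_lt h2))
  rw [ENNReal.coe_pos]
  exact half_pos (mul_pos (nnnorm_pos.2 hc.ne') (nnnorm_pos.2 h3))

theorem IsMusielakOrlicz.measurableSet_lt_finiteBound [μ.IsComplete]
    (hφ : IsMusielakOrlicz μ φ) (s : ℝ≥0) :
    MeasurableSet {t | (s : ℝ≥0∞) < finiteBound (φ t)} := by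
  set d := TopologicalSpace.denseSeq ℝ≥0
  have hm : MeasurableSet (⋃ n, {t | φ t (d n) < ⊤ ∧ s < d n}) :=
    MeasurableSet.iUnion fun n =>
      (measurableSet_lt (hφ.measurable _) measurable_const).inter (MeasurableSet.const _)
  refine NullMeasurableSet.measurable_of_complete (μ := μ) (hm.nullMeasurableSet.congr ?_)
  filter_upwards [hφ.young] with t ht
  refine propext (Iff.trans mem_iUnion (Iff.trans ?_ lt_finiteBound_iff.symm))
  constructor
  · rintro ⟨n, hn⟩
    exact ⟨d n, hn⟩
  · rintro ⟨u, hu, hsu⟩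
    obtain ⟨_, ⟨n, rfl⟩, h1, h2⟩ :=
      (TopologicalSpace.denseRange_denseSeq ℝ≥0).exists_between hsu
    exact ⟨n, (ht.monotone h2.le).trans_lt hu, h1⟩

/-- Off the atoms, it is enough to take the supremum in `φ ⊖ φ₁` over a dense sequence: `φ t` is
increasing and `φ₁ t` is right-continuous on the range of `s`. -/
theorem youngConj_eq_iSup_denseSeq {t : Ω} (ht : t ∉ atomicPart μ) (hφ : IsYoung (φ t))
    (hφ₁ : IsYoung (φ₁ t)) (u : ℝ≥0) :
    youngConj μ φ φ₁ t u = ⨆ n, {t | (TopologicalSpace.denseSeq ℝ≥0 n : ℝ≥0∞) <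
        finiteBound (φ₁ t)}.indicator
      (fun t => φ t (TopologicalSpace.denseSeq ℝ≥0 n * u) -
        φ₁ t (TopologicalSpace.denseSeq ℝ≥0 n)) t := by
  set d := TopologicalSpace.denseSeq ℝ≥0
  rw [youngConj, if_neg ht]
  apply le_antisymm
  · refine iSup₂_le fun s hs => ENNReal.le_of_forall_pos_le_add fun ε hε _ => ?_
    obtain ⟨r, hsr, hr, hle⟩ := hφ₁.exists_forall_le_add hs hε
    obtain ⟨_, ⟨n, rfl⟩, h1, h2⟩ :=
      (TopologicalSpace.denseRange_denseSeq ℝ≥0).exists_between hsr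
    have hmem : t ∈ {t | (d n : ℝ≥0∞) < finiteBound (φ₁ t)} :=
      lt_of_lt_of_le (by exact_mod_cast h2) hr
    calc φ t (s * u) - φ₁ t s ≤ φ t (d n * u) - φ₁ t (d n) + ε := by
          rw [tsub_le_iff_right]
          calc φ t (s * u) ≤ φ t (d n * u) := hφ.monotone (by gcongr)
            _ ≤ φ t (d n * u) - φ₁ t (d n) + φ₁ t (d n) := le_tsub_add
            _ ≤ φ t (d n * u) - φ₁ t (d n) + (φ₁ t s + ε) := by
              gcongr
              exact hle _ h1.le h2.le
            _ = _ := by ring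
      _ ≤ _ := by
        gcongr
        refine le_iSup_of_le n ?_
        rw [indicator_of_mem hmem]
  · refine iSup_le fun n => indicator_apply_le' (fun h => ?_) fun _ => zero_le
    exact le_iSup₂ (f := fun (s : ℝ≥0) (_ : (s : ℝ≥0∞) < finiteBound (φ₁ t)) =>
      φ t (s * u) - φ₁ t s) (d n) h

theorem isMusielakOrlicz_youngConj [SigmaFinite μ] [μ.IsComplete] (hatoms : AtomsAreSingletons μ)
    (hφ : IsMusielakOrlicz μ φ) (hφ₁ : IsMusielakOrlicz μ φ₁)
    (hb : ∀ᵐ t ∂μ, 0 < finiteBound (φ₁ t)) : IsMusielakOrlicz μ (youngConj μ φ φ₁) where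
  young := by
    filter_upwards [hφ.young, hφ₁.young, hb] with t h1 h2 h3 using isYoung_youngConj h1 h2 h3
  measurable u := by
    classical
    refine Measurable.congr_ae (μ := μ)
      (hatoms.measurable_ite (fun t => youngConj μ φ φ₁ t u) (Measurable.iSup fun n =>
        ((hφ.measurable (TopologicalSpace.denseSeq ℝ≥0 n * u)).sub
          (hφ₁.measurable (TopologicalSpace.denseSeq ℝ≥0 n))).indicator
          (hφ₁.measurableSet_lt_finiteBound (TopologicalSpace.denseSeq ℝ≥0 n)))) ?_
    filter_upwards [hφ.young, hφ₁.young] with t h1 h2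
    split_ifs with ht
    · rfl
    · rw [youngConj_eq_iSup_denseSeq ht h1 h2]
      rfl

/-! ### Elements of the conjugate space are multipliers -/

theorem AtomsAreSingletons.mul_measure_singleton_le [SigmaFinite μ] (h : AtomsAreSingletons μ)
    {f : Ω → ℝ≥0∞} {t : Ω} (ht : t ∈ atomicPart μ) : f t * μ {t} ≤ ∫⁻ s, f s ∂μ := by
  rw [← lintegral_indicator_const (h.measurableSet_singleton ht)]
  refine lintegral_mono fun s => indicator_apply_le' (fun hs => ?_) fun _ => zero_le
  rw [mem_singleton_iff.1 hs]

/-- The pointwise Young inequality. Halving `s` moves it from the boundary of the domain of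
finiteness of `φ₁ t` into the range of the supremum. -/
theorem map_half_mul_le_add_youngConj [SigmaFinite μ] {t : Ω} (hφ₁ : IsYoung (φ₁ t))
    (hb : 0 < finiteBound (φ₁ t)) {s : ℝ≥0} (hs : t ∈ atomicPart μ → φ₁ t s * μ {t} ≤ 1) (u : ℝ≥0) :
    φ t (s / 2 * u) ≤ φ₁ t s + youngConj μ φ φ₁ t u := by
  rcases eq_or_ne (φ₁ t s) ⊤ with htop | htop
  · simp [htop]
  have hsb := le_finiteBound (lt_top_iff_ne_top.2 htop)
  have hmem : s / 2 ∈ conjRange μ φ₁ t := by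
    have hcoe : ((s / 2 : ℝ≥0) : ℝ≥0∞) ≤ finiteBound (φ₁ t) / 2 := by
      rw [ENNReal.coe_div two_ne_zero]
      exact ENNReal.div_le_div_right hsb 2
    unfold conjRange
    split_ifs with ht
    · refine le_min (le_trans (by exact_mod_cast half_le_self (zero_le : 0 ≤ s))
        (hφ₁.le_rightInv (s := s) ?_)) hcoe
      rw [ENNReal.le_div_iff_mul_le (Or.inl (ne_of_gt ht))
        (Or.inl (measure_singleton_lt_top t).ne)]
      exact hs ht
    · rcases eq_or_ne s 0 with rfl | h0
      · simpa using hb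
      · refine lt_of_lt_of_le ?_ hsb
        exact_mod_cast NNReal.half_lt_self h0
  rw [add_comm, youngConj_eq_iSup]
  calc φ t (s / 2 * u) ≤ (φ t (s / 2 * u) - φ₁ t (s / 2)) + φ₁ t (s / 2) := le_tsub_add
    _ ≤ _ := add_le_add
      (le_iSup₂ (f := fun s (_ : s ∈ conjRange μ φ₁ t) => φ t (s * u) - φ₁ t s) _ hmem)
      (hφ₁.monotone (half_le_self zero_le))

/-- Hölder's inequality: the integrated form of `map_half_mul_le_add_youngConj`. -/
theorem luxNorm_mul_le [SigmaFinite μ] [μ.IsComplete] (hatoms : AtomsAreSingletons μ)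
    (hφ : IsMusielakOrlicz μ φ) (hφ₁ : IsMusielakOrlicz μ φ₁)
    (hb : ∀ᵐ t ∂μ, 0 < finiteBound (φ₁ t)) {x y : Ω →ₘ[μ] ℝ} {c d : ℝ≥0}
    (hx : luxNorm μ φ₁ x < c) (hy : luxNorm μ (youngConj μ φ φ₁) y < d) :
    luxNorm μ φ (x * y) ≤ (16 * (c * d) : ℝ≥0) := by
  have hψ := isMusielakOrlicz_youngConj hatoms hφ hφ₁ hb
  have hc : 0 < c := by exact_mod_cast (zero_le.trans_lt hx)
  have hd : 0 < d := by exact_mod_cast (zero_le.trans_lt hy)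
  have hIx := hφ₁.lintegral_le_of_luxNorm_lt hx le_rfl
  have hIy := hψ.lintegral_le_of_luxNorm_lt hy le_rfl
  simp only [one_mul, ENNReal.coe_one] at hIx hIy
  obtain ⟨g₁, hg₁, hxg⟩ := hφ₁.exists_measurable_between
    (p := fun t => c⁻¹ * ‖x t‖₊) (x.measurable.nnnorm.const_mul _)
  obtain ⟨g₂, hg₂, hyg⟩ := hψ.exists_measurable_between
    (p := fun t => d⁻¹ * ‖y t‖₊) (y.measurable.nnnorm.const_mul _)
  have hmain : ∫⁻ t, φ t ((8 * (c * d))⁻¹ * ‖(x * y : Ω →ₘ[μ] ℝ) t‖₊) ∂μ ≤ (2 : ℝ≥0) := by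
    calc ∫⁻ t, φ t ((8 * (c * d))⁻¹ * ‖(x * y : Ω →ₘ[μ] ℝ) t‖₊) ∂μ ≤ ∫⁻ t, (g₁ t + g₂ t) ∂μ := by
          refine lintegral_mono_ae ?_
          filter_upwards [AEEqFun.coeFn_mul x y, hxg, hyg, hφ₁.young, hb]
            with t hxy h1 h2 hyoung hpos
          have harg : (8 * (c * d))⁻¹ * ‖(x * y : Ω →ₘ[μ] ℝ) t‖₊ =
              (c⁻¹ * ‖x t‖₊ / 2) / 2 * (d⁻¹ * ‖y t‖₊ / 2) := by
            rw [hxy, Pi.mul_apply, nnnorm_mul]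
            field_simp
            norm_num
            ring
          rw [harg]
          refine (map_half_mul_le_add_youngConj (μ := μ) hyoung hpos (fun ht => ?_) _).trans
            (add_le_add h1.1 h2.1)
          refine le_trans ?_ hIx
          refine le_trans ?_ (hatoms.mul_measure_singleton_le
            (f := fun t => φ₁ t (c⁻¹ * ‖x t‖₊)) ht)
          gcongr
          exact hyoung.monotone (half_le_self zero_le)
      _ = ∫⁻ t, g₁ t ∂μ + ∫⁻ t, g₂ t ∂μ := lintegral_add_left hg₁ _
      _ ≤ 1 + 1 := add_le_add
        ((lintegral_mono_ae (hxg.mono fun t h => h.2)).trans hIx)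
        ((lintegral_mono_ae (hyg.mono fun t h => h.2)).trans hIy)
      _ = (2 : ℝ≥0) := by norm_num
  refine (hφ.luxNorm_le (by positivity) one_le_two hmain).trans (le_of_eq ?_)
  congr 1
  rw [div_inv_eq_mul]
  ring

/-! ### Multipliers are bounded -/

theorem exists_nnnorm_ae_eq {p : Ω → ℝ≥0} (hp : Measurable p) :
    ∃ x : Ω →ₘ[μ] ℝ, ∀ᵐ t ∂μ, ‖x t‖₊ = p t := by
  refine ⟨AEEqFun.mk (fun t => (p t : ℝ)) hp.coe_nnreal_real.aestronglyMeasurable, ?_⟩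
  filter_upwards [AEEqFun.coeFn_mk (μ := μ) (fun t => (p t : ℝ))
    hp.coe_nnreal_real.aestronglyMeasurable] with t ht
  rw [ht, NNReal.nnnorm_eq]

/-- A multiplier has finite operator norm. If there were `x n` in the unit ball with
`‖x n * y‖ > n 2 ^ (n + 1)`, then `sup_n 2 ^ (-n - 1) |x n|` would belong to `L^φ₁`, and its product
with `y` would not belong to `L^φ`. -/
theorem multNorm_lt_top (hφ : IsMusielakOrlicz μ φ) (hφ₁ : IsMusielakOrlicz μ φ₁)
    {y : Ω →ₘ[μ] ℝ} (hy : y ∈ multipliers μ φ₁ φ) : multNorm μ φ₁ φ y < ⊤ := by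
  by_contra hcon
  rw [not_lt_top_iff] at hcon
  have hex : ∀ n : ℕ, ∃ x : Ω →ₘ[μ] ℝ, luxNorm μ φ₁ x ≤ 1 ∧
      ((n * 2 ^ (n + 1) : ℝ≥0) : ℝ≥0∞) < luxNorm μ φ (x * y) := fun n => by
    have h : ((n * 2 ^ (n + 1) : ℝ≥0) : ℝ≥0∞) < multNorm μ φ₁ φ y := by
      rw [hcon]
      exact ENNReal.coe_lt_top
    simp only [multNorm, lt_iSup_iff] at h
    obtain ⟨x, ⟨-, hx⟩, hxy⟩ := h
    exact ⟨x, hx, hxy⟩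
  choose x hx hxy using hex
  set z : ℕ → Ω → ℝ≥0 := fun n t => (2 ^ (n + 1))⁻¹ * ‖x n t‖₊ with hz
  have hzm : ∀ n, Measurable (z n) := fun n => (x n).measurable.nnnorm.const_mul _
  have hIz : ∀ n, ∫⁻ t, φ₁ t (z n t) ∂μ ≤ (2⁻¹ : ℝ≥0∞) ^ n := fun n => by
    have h := hφ₁.lintegral_le_of_luxNorm_lt (x := x n) (c := 2) (a := 2⁻¹ ^ n)
      ((hx n).trans_lt (by norm_num)) (pow_le_one₀ zero_le (by norm_num))
    have harg : ∀ t, (2⁻¹ : ℝ≥0) ^ n * (2⁻¹ * ‖x n t‖₊) = z n t := fun t => by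
      simp only [hz, pow_succ, mul_inv, inv_pow, mul_assoc]
    simp only [harg] at h
    refine h.trans (le_of_eq ?_)
    rw [ENNReal.coe_pow, ENNReal.coe_inv two_ne_zero, ENNReal.coe_ofNat]
  choose g hg hzg using fun n => hφ₁.exists_measurable_between (hzm n)
  have hGm : Measurable fun t => ∑' n, g n t := Measurable.tsum hg
  have hGfin : ∫⁻ t, ∑' n, g n t ∂μ ≠ ⊤ := by
    rw [lintegral_tsum fun n => (hg n).aemeasurable]
    refine ne_top_of_le_ne_top (b := ∑' n : ℕ, (2⁻¹ : ℝ≥0∞) ^ n) ?_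
      (ENNReal.tsum_le_tsum fun n =>
        (lintegral_mono_ae ((hzg n).mono fun t h => h.2)).trans (hIz n))
    rw [ENNReal.tsum_geometric, ENNReal.one_sub_inv_two, inv_inv]
    exact ENNReal.ofNat_ne_top
  have hle : ∀ᵐ t ∂μ, ∀ n, φ₁ t (z n t / 2) ≤ ∑' n, g n t := by
    filter_upwards [ae_all_iff.2 hzg] with t ht n
    exact (ht n).1.trans (ENNReal.le_tsum n)
  have hbdd : ∀ᵐ t ∂μ, BddAbove (range fun n => z n t) := by
    filter_upwards [hle, ae_lt_top hGm hGfin, hφ₁.young] with t h1 h2 h3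
    obtain ⟨u, hu⟩ := (h3.tendsto_top.eventually (lt_mem_nhds h2)).exists
    refine ⟨2 * u, ?_⟩
    rintro _ ⟨n, rfl⟩
    have h4 : z n t / 2 < u := h3.monotone.reflect_lt ((h1 n).trans_lt hu)
    rw [div_lt_iff₀ two_pos, mul_comm] at h4
    exact h4.le
  obtain ⟨w, hw⟩ := exists_nnnorm_ae_eq (μ := μ) (p := fun t => ⨆ n, z n t) (Measurable.iSup hzm)
  -- One halving replaces `w` by one of the `z n`, the other replaces `φ₁ t (z n t)` by `g n t`.
  have hwmem : w ∈ space μ φ₁ := by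
    refine ⟨4⁻¹, by norm_num, ?_⟩
    rw [modular_smul]
    refine (lintegral_mono_ae ?_).trans_lt (lt_top_iff_ne_top.2 hGfin)
    filter_upwards [hle, hbdd, hφ₁.young, hw] with t h1 h2 h3 h4
    rw [h4]
    rcases eq_or_ne (⨆ n, z n t) 0 with h0 | h0
    · simp [h0, h3.map_zero]
    obtain ⟨n, hn⟩ := exists_lt_of_lt_ciSup (NNReal.half_lt_self h0)
    refine (h3.monotone ?_).trans (h1 n)
    have h5 : ‖(4⁻¹ : ℝ)‖₊ = 2⁻¹ * 2⁻¹ := by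
      apply NNReal.eq
      simp
      norm_num
    rw [h5, mul_assoc, div_eq_inv_mul]
    rw [div_eq_inv_mul] at hn
    gcongr
  obtain ⟨c, hc, hmod⟩ := hy w hwmem
  rw [modular_smul] at hmod
  set K := max 1 (∫⁻ t, φ t (‖c‖₊ * ‖(w * y : Ω →ₘ[μ] ℝ) t‖₊) ∂μ).toNNReal
  have hK : ∫⁻ t, φ t (‖c‖₊ * ‖(w * y : Ω →ₘ[μ] ℝ) t‖₊) ∂μ ≤ K := by
    conv_lhs => rw [← ENNReal.coe_toNNReal hmod.ne]
    exact_mod_cast le_max_right _ _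
  have hc0 : 0 < ‖c‖₊ := nnnorm_pos.2 hc.ne'
  have hbound : ∀ n : ℕ, (n : ℝ≥0) < K / ‖c‖₊ := fun n => by
    have h1 : luxNorm μ φ (x n * y) ≤ (K / (‖c‖₊ * (2 ^ (n + 1))⁻¹) : ℝ≥0) := by
      refine hφ.luxNorm_le (by positivity) (le_max_left _ _) (le_trans (lintegral_mono_ae ?_) hK)
      filter_upwards [hbdd, hφ.young, hw, AEEqFun.coeFn_mul (x n) y, AEEqFun.coeFn_mul w y]
        with t h2 h3 h4 h5 h6
      refine h3.monotone ?_
      rw [h5, h6, Pi.mul_apply, Pi.mul_apply, nnnorm_mul, nnnorm_mul, h4, mul_assoc,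
        ← mul_assoc _ ‖x n t‖₊]
      gcongr
      exact le_ciSup h2 n
    have h2 : (n * 2 ^ (n + 1) : ℝ≥0) < K / (‖c‖₊ * (2 ^ (n + 1))⁻¹) := by
      exact_mod_cast (hxy n).trans_le h1
    rw [div_mul_eq_div_div, div_inv_eq_mul] at h2
    exact lt_of_mul_lt_mul_right h2 zero_le
  obtain ⟨n, hn⟩ := exists_nat_gt (K / ‖c‖₊)
  exact lt_asymm hn (hbound n)

/-! ### Multipliers belong to the conjugate space -/

/-- Measurable functions `s` with `t ↦ φ₁ t (s t)` measurable and finite, whose restriction to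
each atom has modular at most one. -/
structure IsAdmissible (μ : Measure Ω) (φ₁ : Ω → ℝ≥0 → ℝ≥0∞) (s : Ω → ℝ≥0) : Prop where
  measurable : Measurable s
  measurable_map : Measurable fun t => φ₁ t (s t)
  ae_lt_top : ∀ᵐ t ∂μ, φ₁ t (s t) < ⊤
  atom_le : ∀ᵐ t ∂μ, t ∈ atomicPart μ → φ₁ t (s t) * μ {t} ≤ 1

theorem IsAdmissible.piecewise {s r : Ω → ℝ≥0} (hs : IsAdmissible μ φ₁ s)
    (hr : IsAdmissible μ φ₁ r) {A : Set Ω} (hA : MeasurableSet A) [DecidablePred (· ∈ A)] :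
    IsAdmissible μ φ₁ (A.piecewise s r) where
  measurable := hs.measurable.piecewise hA hr.measurable
  measurable_map := by
    have h : (fun t => φ₁ t (A.piecewise s r t)) =
        A.piecewise (fun t => φ₁ t (s t)) (fun t => φ₁ t (r t)) := by
      ext t
      by_cases ht : t ∈ A <;> simp [ht]
    rw [h]
    exact hs.measurable_map.piecewise hA hr.measurable_map
  ae_lt_top := by
    filter_upwards [hs.ae_lt_top, hr.ae_lt_top] with t h1 h2
    by_cases ht : t ∈ A <;> simpa [ht]
  atom_le := by
    filter_upwards [hs.atom_le, hr.atom_le] with t h1 h2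
    by_cases ht : t ∈ A <;> simpa [ht]

theorem forall_atomicPart_of_ae {P : Ω → Prop} (h : ∀ᵐ t ∂μ, P t) {t : Ω}
    (ht : t ∈ atomicPart μ) : P t := by
  by_contra hP
  exact absurd (measure_mono_null (singleton_subset_iff.2 (show t ∈ {t | ¬P t} from hP)) h)
    (ne_of_gt ht)

/-- Suppose that multiplication by `q` takes functions of `φ₁`-modular at most `1` to functions of
`φ`-modular at most `1/2`. If `φ₁ t (s t) ≤ φ t (s t * q t)`, then no restriction of `s` has
`φ₁`-modular in `(1/2, 1]`, so that the gap principle applies to `s`. -/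
theorem IsAdmissible.lintegral_le_half [SigmaFinite μ] (hatoms : AtomsAreSingletons μ)
    (hφ₁ : IsMusielakOrlicz μ φ₁) {q s : Ω → ℝ≥0}
    (hq : ∀ p : Ω → ℝ≥0, Measurable p → ∫⁻ t, φ₁ t (p t) ∂μ ≤ 1 →
      ∫⁻ t, φ t (p t * q t) ∂μ ≤ 2⁻¹)
    (hs : IsAdmissible μ φ₁ s) (hle : ∀ᵐ t ∂μ, φ₁ t (s t) ≤ φ t (s t * q t)) :
    ∫⁻ t, φ t (s t * q t) ∂μ ≤ 2⁻¹ := by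
  refine hq s hs.measurable (le_trans (hatoms.lintegral_le_half_of_gap hs.measurable_map
    hs.ae_lt_top (fun t ht => forall_atomicPart_of_ae hs.atom_le ht ht) fun A hA h1 => ?_)
    (by simp))
  rw [← lintegral_indicator hA] at h1 ⊢
  have hint : ∫⁻ t, φ₁ t (A.indicator s t) ∂μ = ∫⁻ t, A.indicator (fun t => φ₁ t (s t)) t ∂μ := by
    refine lintegral_congr_ae ?_
    filter_upwards [hφ₁.young] with t ht
    by_cases htA : t ∈ A <;> simp [htA, ht.map_zero]
  refine le_trans (lintegral_mono_ae ?_) (hq (A.indicator s) (hs.measurable.indicator hA)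
    (hint.trans_le h1))
  filter_upwards [hle] with t ht
  by_cases htA : t ∈ A <;> simp [htA, ht]

/-- A countable family of admissible functions that meets `[r / 2, r]` for each nonzero `r` in the
range of the supremum defining `φ ⊖ φ₁`. On an atom, where this range is a closed interval
`[0, ρ t]`, the values are cut off at `ρ t / 2`, strictly below `φ₁⁻¹(t, 1 / μ {t})`. -/
theorem exists_admissible_seq [SigmaFinite μ] [μ.IsComplete] (hatoms : AtomsAreSingletons μ)
    (hφ₁ : IsMusielakOrlicz μ φ₁) (hb : ∀ᵐ t ∂μ, 0 < finiteBound (φ₁ t)) :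
    ∃ s : ℕ → Ω → ℝ≥0, (∀ n, IsAdmissible μ φ₁ (s n)) ∧
      ∀ᵐ t ∂μ, ∀ r ∈ conjRange μ φ₁ t, r ≠ 0 → ∃ n, r / 2 ≤ s n t ∧ s n t ≤ r := by
  classical
  set d := TopologicalSpace.denseSeq ℝ≥0
  set ρ : Ω → ℝ≥0 := fun t =>
    (min (rightInv (φ₁ t) (1 / μ {t})) (finiteBound (φ₁ t) / 2)).toNNReal with hρ
  set s : ℕ → Ω → ℝ≥0 := fun n t => if t ∈ atomicPart μ then min (d n) (ρ t / 2) else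
    if (d n : ℝ≥0∞) < finiteBound (φ₁ t) then d n else 0 with hs
  have hρeq : ∀ t ∈ atomicPart μ, IsYoung (φ₁ t) →
      (ρ t : ℝ≥0∞) = min (rightInv (φ₁ t) (1 / μ {t})) (finiteBound (φ₁ t) / 2) :=
    fun t ht hy => ENNReal.coe_toNNReal ((min_le_left _ _).trans_lt (hy.rightInv_lt_top
      (ENNReal.div_ne_top ENNReal.one_ne_top (ne_of_gt ht)))).ne
  refine ⟨s, fun n => ⟨?_, ?_, ?_, ?_⟩, ?_⟩
  · exact hatoms.measurable_ite _ (Measurable.ite (hφ₁.measurableSet_lt_finiteBound _)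
      measurable_const measurable_const)
  · simp only [hs, apply_ite (φ₁ _)]
    exact hatoms.measurable_ite _ (Measurable.ite (hφ₁.measurableSet_lt_finiteBound _)
      (hφ₁.measurable _) (hφ₁.measurable _))
  · filter_upwards [hφ₁.young, hb] with t hy hpos
    refine hy.lt_top_of_lt_finiteBound ?_
    simp only [hs]
    split_ifs with ht h
    · refine lt_finiteBound_of_mem_conjRange (μ := μ) hpos
        (conjRange_mem_of_le (r := ρ t) ?_ ((min_le_right _ _).trans (half_le_self zero_le)))
      simp only [conjRange, if_pos ht, mem_ofPred_eq]
      exact (hρeq t ht hy).le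
    · exact h
    · simpa using hpos
  · filter_upwards [hφ₁.young] with t hy ht
    simp only [hs, if_pos ht]
    rcases eq_or_ne (ρ t) 0 with h0 | h0
    · simp [h0, hy.map_zero]
    have hlt : ((min (d n) (ρ t / 2) : ℝ≥0) : ℝ≥0∞) < rightInv (φ₁ t) (1 / μ {t}) := by
      refine lt_of_lt_of_le ?_ ((hρeq t ht hy).le.trans (min_le_left _ _))
      exact_mod_cast (min_le_right _ _).trans_lt (NNReal.half_lt_self h0)
    calc φ₁ t (min (d n) (ρ t / 2)) * μ {t} ≤ 1 / μ {t} * μ {t} := by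
          gcongr
          exact le_of_lt_rightInv hlt
      _ ≤ 1 := by
        rw [one_div]
        exact ENNReal.inv_mul_le_one _
  · filter_upwards [hφ₁.young] with t hy r hr h0
    obtain ⟨_, ⟨n, rfl⟩, h1, h2⟩ := (TopologicalSpace.denseRange_denseSeq ℝ≥0).exists_between
      (NNReal.half_lt_self h0)
    refine ⟨n, ?_⟩
    simp only [conjRange] at hr
    by_cases ht : t ∈ atomicPart μ
    · simp only [if_pos ht, mem_ofPred_eq, ← hρeq t ht hy, ENNReal.coe_le_coe] at hr
      simp only [hs, if_pos ht]
      exact ⟨le_min h1.le (by gcongr), (min_le_left _ _).trans h2.le⟩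
    · simp only [if_neg ht, mem_ofPred_eq] at hr
      have hdn : (d n : ℝ≥0∞) < finiteBound (φ₁ t) := lt_trans (by exact_mod_cast h2) hr
      simp only [hs, if_neg ht, if_pos hdn]
      exact ⟨h1.le, h2.le⟩

/-- If multiplication by `q` takes functions of `φ₁`-modular at most `1` to functions of
`φ`-modular at most `1/2`, then `q / 4` has `φ ⊖ φ₁`-modular at most `1/2`. The supremum is
approximated by a maximum of finitely many terms `φ t (s t * q t) - φ₁ t (s t)` with `s`
admissible, and the index of the largest term is chosen measurably in `t`. -/
theorem lintegral_youngConj_le [SigmaFinite μ] [μ.IsComplete] (hatoms : AtomsAreSingletons μ)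
    (hφ : IsMusielakOrlicz μ φ) (hφ₁ : IsMusielakOrlicz μ φ₁)
    (hb : ∀ᵐ t ∂μ, 0 < finiteBound (φ₁ t)) {q : Ω → ℝ≥0} (hqm : Measurable q)
    (hq : ∀ p : Ω → ℝ≥0, Measurable p → ∫⁻ t, φ₁ t (p t) ∂μ ≤ 1 →
      ∫⁻ t, φ t (p t * q t) ∂μ ≤ 2⁻¹) :
    ∫⁻ t, youngConj μ φ φ₁ t (q t / 4) ∂μ ≤ 2⁻¹ := by
  classical
  obtain ⟨s, hs, hdense⟩ := exists_admissible_seq hatoms hφ₁ hb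
  choose g hg hsg using fun n =>
    hφ.exists_measurable_between (p := fun t => s n t * q t) ((hs n).measurable.mul hqm)
  set D : ℕ → Ω → ℝ≥0∞ := fun n t => g n t - φ₁ t (s n t) with hD
  have hDm : ∀ n, Measurable (D n) := fun n => (hg n).sub (hs n).measurable_map
  set G : ℕ → Ω → ℝ≥0∞ := fun n t => (Finset.range n).sup fun k => D k t with hG
  have hGsucc : ∀ n t, G (n + 1) t = max (D n t) (G n t) := fun n t => by
    simp only [hG, Finset.range_add_one, Finset.sup_insert]
  have hsel : ∀ n, Measurable (G n) ∧ ∃ r : Ω → ℝ≥0, IsAdmissible μ φ₁ r ∧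
      ∀ᵐ t ∂μ, φ₁ t (r t) + G n t ≤ φ t (r t * q t) := by
    intro n
    induction n with
    | zero =>
      have h0 : ∀ᵐ t ∂μ, φ₁ t 0 = 0 := hφ₁.young.mono fun t h => h.map_zero
      refine ⟨by simp [hG], fun _ => 0,
        ⟨measurable_const, hφ₁.measurable 0, ?_, ?_⟩, ?_⟩
      · filter_upwards [h0] with t ht
        simp [ht]
      · filter_upwards [h0] with t ht
        simp [ht]
      · filter_upwards [h0] with t ht
        simp [ht, hG]
    | succ n ih =>
      obtain ⟨hGm, r, hr, hrle⟩ := ih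
      have hA : MeasurableSet {t | G n t < D n t} := measurableSet_lt hGm (hDm n)
      refine ⟨?_, {t | G n t < D n t}.piecewise (s n) r, (hs n).piecewise hr hA, ?_⟩
      · simp only [funext (hGsucc n)]
        exact (hDm n).max hGm
      filter_upwards [hrle, hsg n] with t h1 h2
      rw [hGsucc]
      by_cases ht : G n t < D n t
      · rw [piecewise_eq_of_mem _ _ _ (show t ∈ {t | G n t < D n t} from ht), max_eq_left ht.le]
        have hpos : φ₁ t (s n t) < g n t := tsub_pos_iff_lt.1 (zero_le.trans_lt ht)
        rw [hD, add_tsub_cancel_of_le hpos.le]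
        exact h2.2
      · rw [piecewise_eq_of_notMem _ _ _ (show t ∉ {t | G n t < D n t} from ht),
          max_eq_right (not_lt.1 ht)]
        exact h1
  have hGint : ∀ n, ∫⁻ t, G n t ∂μ ≤ 2⁻¹ := fun n => by
    obtain ⟨-, r, hr, hrle⟩ := hsel n
    refine le_trans (lintegral_mono_ae ?_) (hr.lintegral_le_half hatoms hφ₁ hq
      (hrle.mono fun t h => le_self_add.trans h))
    exact hrle.mono fun t h => le_add_self.trans h
  have hGmono : Monotone G := monotone_nat_of_le_succ fun n t => by
    rw [hGsucc]
    exact le_max_right _ _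
  calc ∫⁻ t, youngConj μ φ φ₁ t (q t / 4) ∂μ ≤ ∫⁻ t, ⨆ n, G n t ∂μ := by
        refine lintegral_mono_ae ?_
        filter_upwards [hdense, ae_all_iff.2 hsg, hφ.young, hφ₁.young] with t h1 h2 h3 h4
        rw [youngConj_eq_iSup]
        refine iSup₂_le fun r hr => ?_
        rcases eq_or_ne r 0 with rfl | h0
        · simp [h3.map_zero]
        obtain ⟨n, hn1, hn2⟩ := h1 r hr h0
        refine le_trans ?_ (le_iSup _ (n + 1))
        rw [hGsucc]
        refine le_trans (tsub_le_tsub (le_trans (h3.monotone ?_) (h2 n).1) (h4.monotone hn2))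
          (le_max_left _ _)
        have harg : r * (q t / 4) = r / 2 * (q t / 2) := by
          field_simp
          norm_num
        rw [harg, mul_div_assoc]
        gcongr
    _ = ⨆ n, ∫⁻ t, G n t ∂μ := lintegral_iSup (fun n => (hsel n).1) hGmono
    _ ≤ 2⁻¹ := iSup_le hGint

theorem luxNorm_youngConj_le [SigmaFinite μ] [μ.IsComplete] (hatoms : AtomsAreSingletons μ)
    (hφ : IsMusielakOrlicz μ φ) (hφ₁ : IsMusielakOrlicz μ φ₁)
    (hb : ∀ᵐ t ∂μ, 0 < finiteBound (φ₁ t)) {y : Ω →ₘ[μ] ℝ} {c : ℝ≥0}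
    (hy : multNorm μ φ₁ φ y < c) : luxNorm μ (youngConj μ φ φ₁) y ≤ (8 * c : ℝ≥0) := by
  have hc : 0 < c := by exact_mod_cast (zero_le.trans_lt hy)
  have h := lintegral_youngConj_le hatoms hφ hφ₁ hb (q := fun t => 2⁻¹ * (c⁻¹ * ‖y t‖₊))
    ((y.measurable.nnnorm.const_mul _).const_mul _) fun p hp hp1 => by
      obtain ⟨x, hx⟩ := exists_nnnorm_ae_eq (μ := μ) hp
      have hx1 : luxNorm μ φ₁ x ≤ 1 := by
        have h1 : ∫⁻ t, φ₁ t (1 * ‖x t‖₊) ∂μ ≤ (1 : ℝ≥0) := by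
          rw [ENNReal.coe_one]
          refine le_trans (le_of_eq (lintegral_congr_ae ?_)) hp1
          filter_upwards [hx] with t ht
          rw [one_mul, ht]
        simpa using hφ₁.luxNorm_le one_pos le_rfl h1
      have hxy : luxNorm μ φ (x * y) < c := lt_of_le_of_lt
        (le_iSup₂ (f := fun (x : Ω →ₘ[μ] ℝ) (_ : x ∈ space μ φ₁ ∧ luxNorm μ φ₁ x ≤ 1) =>
          luxNorm μ φ (x * y)) x
          ⟨hφ₁.mem_space_iff.2 (hx1.trans_lt ENNReal.one_lt_top), hx1⟩) hy
      have h2 := hφ.lintegral_le_of_luxNorm_lt hxy (a := 2⁻¹) (by norm_num)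
      rw [ENNReal.coe_inv two_ne_zero, ENNReal.coe_ofNat] at h2
      refine le_trans (le_of_eq (lintegral_congr_ae ?_)) h2
      filter_upwards [hx, AEEqFun.coeFn_mul x y] with t h3 h4
      rw [h4, Pi.mul_apply, nnnorm_mul, h3]
      congr 1
      ring
  have h8 : ∫⁻ t, youngConj μ φ φ₁ t ((8 * c)⁻¹ * ‖y t‖₊) ∂μ ≤ (1 : ℝ≥0) := by
    have harg : ∀ t, (8 * c)⁻¹ * ‖y t‖₊ = 2⁻¹ * (c⁻¹ * ‖y t‖₊) / 4 := fun t => by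
      field_simp
      ring
    simp only [harg]
    exact h.trans (by simp)
  refine ((isMusielakOrlicz_youngConj hatoms hφ hφ₁ hb).luxNorm_le (by positivity) le_rfl
    h8).trans (le_of_eq ?_)
  rw [one_div, inv_inv]

theorem le_coe_mul_of_forall_lt_coe {a b : ℝ≥0∞} {C : ℝ≥0} (hC : 0 < C)
    (h : ∀ d : ℝ≥0, a < d → b ≤ (C * d : ℝ≥0)) : b ≤ C * a := by
  have hC' : (C : ℝ≥0∞) ≠ 0 := by exact_mod_cast hC.ne'
  rw [mul_comm, ← ENNReal.div_le_iff hC' ENNReal.coe_ne_top]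
  refine le_of_forall_gt_imp_ge_of_dense fun e he => ?_
  obtain ⟨d, had, hde⟩ := ENNReal.lt_iff_exists_nnreal_btwn.1 he
  rw [ENNReal.div_le_iff hC' ENNReal.coe_ne_top, mul_comm]
  refine (h d had).trans ?_
  rw [ENNReal.coe_mul]
  gcongr

end MusielakOrlicz

theorem theorem1 {Ω : Type*} [MeasurableSpace Ω] (μ : MeasureTheory.Measure Ω)
    [MeasureTheory.SigmaFinite μ] [μ.IsComplete]
    (hatoms : MusielakOrlicz.AtomsAreSingletons μ)
    (φ φ₁ : Ω → ℝ≥0 → ℝ≥0∞)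
    (hφ : MusielakOrlicz.IsMusielakOrlicz μ φ)
    (hφ₁ : MusielakOrlicz.IsMusielakOrlicz μ φ₁)
    (hsupp : MusielakOrlicz.IsSupport μ (MusielakOrlicz.space μ φ₁) Set.univ) :
    MusielakOrlicz.IsMusielakOrlicz μ (MusielakOrlicz.youngConj μ φ φ₁) ∧
    MusielakOrlicz.multipliers μ φ₁ φ =
      MusielakOrlicz.space μ (MusielakOrlicz.youngConj μ φ φ₁) ∧
    ∃ C : ℝ≥0, 0 < C ∧ ∀ y ∈ MusielakOrlicz.multipliers μ φ₁ φ,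
      MusielakOrlicz.multNorm μ φ₁ φ y < ⊤ ∧
      MusielakOrlicz.luxNorm μ (MusielakOrlicz.youngConj μ φ φ₁) y < ⊤ ∧
      MusielakOrlicz.multNorm μ φ₁ φ y ≤
        C * MusielakOrlicz.luxNorm μ (MusielakOrlicz.youngConj μ φ φ₁) y ∧
      MusielakOrlicz.luxNorm μ (MusielakOrlicz.youngConj μ φ φ₁) y ≤
        C * MusielakOrlicz.multNorm μ φ₁ φ y := by
  have hb := hφ₁.ae_finiteBound_pos hsupp
  have hψ := MusielakOrlicz.isMusielakOrlicz_youngConj hatoms hφ hφ₁ hb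
  have hle : ∀ y, MusielakOrlicz.luxNorm μ (MusielakOrlicz.youngConj μ φ φ₁) y ≤
      (8 : ℝ≥0) * MusielakOrlicz.multNorm μ φ₁ φ y := fun y =>
    MusielakOrlicz.le_coe_mul_of_forall_lt_coe (by norm_num) fun c hc =>
      MusielakOrlicz.luxNorm_youngConj_le hatoms hφ hφ₁ hb hc
  have hfin : ∀ y ∈ MusielakOrlicz.multipliers μ φ₁ φ,
      MusielakOrlicz.luxNorm μ (MusielakOrlicz.youngConj μ φ φ₁) y < ⊤ := fun y hy =>
    (hle y).trans_lt (ENNReal.mul_lt_top ENNReal.coe_lt_top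
      (MusielakOrlicz.multNorm_lt_top hφ hφ₁ hy))
  refine ⟨hψ, Subset.antisymm (fun y hy => hψ.mem_space_iff.2 (hfin y hy)) (fun y hy x hx => ?_),
    32, by norm_num, fun y hy => ⟨MusielakOrlicz.multNorm_lt_top hφ hφ₁ hy, hfin y hy, ?_, ?_⟩⟩
  · obtain ⟨c, hc, -⟩ := ENNReal.lt_iff_exists_nnreal_btwn.1 (hφ₁.mem_space_iff.1 hx)
    obtain ⟨d, hd, -⟩ := ENNReal.lt_iff_exists_nnreal_btwn.1 (hψ.mem_space_iff.1 hy)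
    exact hφ.mem_space_iff.2 ((MusielakOrlicz.luxNorm_mul_le hatoms hφ hφ₁ hb hc hd).trans_lt
      ENNReal.coe_lt_top)
  · refine MusielakOrlicz.le_coe_mul_of_forall_lt_coe (by norm_num) fun d hd =>
      iSup₂_le fun x hx => ?_
    refine (MusielakOrlicz.luxNorm_mul_le hatoms hφ hφ₁ hb (c := 2)
      (hx.2.trans_lt (by norm_num)) hd).trans (le_of_eq ?_)
    congr 1
    ring
  · refine (hle y).trans ?_
    gcongr
    norm_num
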